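/- **Process.** A homogeneous (memoryless) rumor spreading process on $n$ nodes proceeds in rounds; informed nodes never become uninformed, the law of the set of nodes informed after a round depends only on the set informed before it, and in a round starting with $k\ge 1$ informed nodes each uninformed node becomes informed with the same probability $p_k$ (with no assumption on the joint law of these events). Let $c_k$ be the smallest number such that in every round starting with $k$ informed nodes, $\operatorname{Cov}[X_1,X_2]\le c_k$ for the indicator variables $X_1,X_2$ of the events that two distinct uninformed nodes $x_1,x_2$ become informed (if there is only one uninformed node, $c_k$ imposes no condition). Let $T(k,m)$ be the number of rounds it takes to get from exactly $k$ informed nodes to $m$ or more informed nodes. **Conditions.** Let one such process be given for every $n$. Let $\rho_n$ be bounded between two positive constants, let $0<g<1$ and $a,c\ge 0$. The *upper* (respectively *lower*) *exponential shrinking conditions* are that for all sufficiently large $n$ and all integers $u$ with $1\le u\le gn$, 1. $1-p_{n-u}\le e^{-\rho_n}+a\frac un$ (respectively $1-p_{n-u}\ge e^{-\rho_n}-a\frac un$), 2. $c_{n-u}\le \frac cu$, 3. $e^{-\rho_n}+ag\le q$ for some constant $q<1$ that does not depend on $n$ (respectively $p_{n-u}\le q$ for some constant $q<1$ that does not depend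 on $n$ and $u$; this holds in particular if $e^{-\rho_n}-ag$ is bounded below by a positive constant). **Theorem.** If the upper exponential shrinking conditions hold, then there are constants $C$ and $A',\alpha'>0$ such that for all sufficiently large $n$ $$\mathbb E[T(n-\lfloor gn\rfloor,n)]\le \tfrac1{\rho_n}\ln n+C,\qquad \Pr\big[T(n-\lfloor gn\rfloor,n)\ge \tfrac1{\rho_n}\ln n+r\big]\le A'e^{-\alpha' r}\quad\text{for all } r\in\mathbb N.$$ If the lower exponential shrinking conditions hold, then there are constants $C$ and $A',\alpha'>0$ such that for all sufficiently large $n$ $$\mathbb E[T(n-\lfloor gn\rfloor,n)]\ge \tfrac1{\rho_n}\ln n-C,\qquad \Pr\big[T(n-\lfloor gn\rfloor,n)\le \tfrac1{\rho_n}\ln n-r\big]\le A'e^{-\alpha' r}\quad\text{for all } r\in\mathbb N.$$ -/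

import Mathlib

open MeasureTheory ProbabilityTheory Filter
open scoped ENNReal

/-- A homogeneous (memoryless) rumor spreading process on the nodes `Fin n`, given by its one-round
dynamics. If the set of informed nodes at the beginning of a round is `S`, then the set of informed
nodes at the end of this round has law `step S`. Informed nodes never become uninformed, and in a
round starting with `k ≥ 1` informed nodes each uninformed node becomes informed with
probability `p k`. Nothing is assumed on the joint law of these events. -/
structure RumorProcess (n : ℕ) where
  step : Finset (Fin n) → PMF (Finset (Fin n))
  p : ℕ → ℝ
  subset_of_mem_support : ∀ S, ∀ S' ∈ (step S).support, S ⊆ S'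
  prob_informed : ∀ S : Finset (Fin n), S.Nonempty → ∀ x, x ∉ S →
    (step S).toMeasure.real {S' | x ∈ S'} = p S.card

namespace RumorProcess

variable {n : ℕ}

open Classical in
/-- The indicator random variable of the event that node `x` is informed at the end of the round,
as a function of the set of nodes that are informed at the end of the round. -/
noncomputable def informedIndicator (x : Fin n) (S' : Finset (Fin n)) : ℝ :=
  if x ∈ S' then 1 else 0

/-- The covariance number `c_k`: the smallest number that bounds
`Cov[X₁, X₂]` for all rounds starting with `k` informed nodes and all pairs of distinct
uninformed nodes. It is the maximum of a finite set, which is nonempty for `1 ≤ k ≤ n - 2`;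
if there are no two distinct uninformed nodes, the value is `0`. -/
noncomputable def covNumber (Q : RumorProcess n) (k : ℕ) : ℝ :=
  sSup {r : ℝ | ∃ S : Finset (Fin n), S.card = k ∧ ∃ x₁ x₂ : Fin n, x₁ ∉ S ∧ x₂ ∉ S ∧ x₁ ≠ x₂ ∧
    r = covariance (informedIndicator x₁) (informedIndicator x₂) (Q.step S).toMeasure}

/-- `X t` is the set of informed nodes at the end of round `t` (at the beginning for `t = 0`) in
a run of the process: a Markov chain with transition law `Q.step`, with arbitrary initial law. -/
structure IsRun (Q : RumorProcess n) {Ω : Type*} [MeasurableSpace Ω] (P : Measure Ω)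
    (X : ℕ → Ω → Finset (Fin n)) : Prop where
  measurable : ∀ t, Measurable (X t)
  markov : ∀ (t : ℕ) (h : ℕ → Finset (Fin n)),
    P {ω | ∀ i ≤ t + 1, X i ω = h i} = P {ω | ∀ i ≤ t, X i ω = h i} * Q.step (h t) (h (t + 1))

end RumorProcess

/-- The number of rounds, counted from time `0`, until at least `m` nodes are informed
(`⊤` if this never happens). For a run with `|X 0| = k` this is the time `T(k, m)`. -/
noncomputable def spreadTime {n : ℕ} {Ω : Type*} (X : ℕ → Ω → Finset (Fin n)) (m : ℕ) (ω : Ω) :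
    ℝ≥0∞ :=
  ⨅ (t : ℕ) (_ : m ≤ (X t ω).card), (t : ℝ≥0∞)

/-- The upper exponential shrinking conditions, for a family of processes, one for each number `n`
of nodes. -/
structure UpperExpShrinking (Q : ∀ n, RumorProcess n) (ρ : ℕ → ℝ) (g a c : ℝ) : Prop where
  rho_bdd : ∃ ρ₀ ρ₁ : ℝ, 0 < ρ₀ ∧ ∀ n, ρ₀ ≤ ρ n ∧ ρ n ≤ ρ₁
  g_pos : 0 < g
  g_lt_one : g < 1
  a_nonneg : 0 ≤ a
  c_nonneg : 0 ≤ c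
  stay_le : ∀ᶠ n : ℕ in atTop, ∀ u : ℕ, 1 ≤ u → (u : ℝ) ≤ g * n →
    1 - (Q n).p (n - u) ≤ Real.exp (-ρ n) + a * (u / n)
  cov_le : ∀ᶠ n : ℕ in atTop, ∀ u : ℕ, 1 ≤ u → (u : ℝ) ≤ g * n →
    (Q n).covNumber (n - u) ≤ c / u
  /-- `e^{-ρ_n} + a g < 1`, uniformly in `n`. -/
  shrink : ∃ q : ℝ, q < 1 ∧ ∀ᶠ n : ℕ in atTop, Real.exp (-ρ n) + a * g ≤ q

/-- The lower exponential shrinking conditions. -/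
structure LowerExpShrinking (Q : ∀ n, RumorProcess n) (ρ : ℕ → ℝ) (g a c : ℝ) : Prop where
  rho_bdd : ∃ ρ₀ ρ₁ : ℝ, 0 < ρ₀ ∧ ∀ n, ρ₀ ≤ ρ n ∧ ρ n ≤ ρ₁
  g_pos : 0 < g
  g_lt_one : g < 1
  a_nonneg : 0 ≤ a
  c_nonneg : 0 ≤ c
  le_stay : ∀ᶠ n : ℕ in atTop, ∀ u : ℕ, 1 ≤ u → (u : ℝ) ≤ g * n →
    Real.exp (-ρ n) - a * (u / n) ≤ 1 - (Q n).p (n - u)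
  cov_le : ∀ᶠ n : ℕ in atTop, ∀ u : ℕ, 1 ≤ u → (u : ℝ) ≤ g * n →
    (Q n).covNumber (n - u) ≤ c / u
  /-- The success probabilities are bounded away from `1`, uniformly in `n` and `u`. This follows
  from the other conditions if `a * g < e^{-ρ_n}` holds uniformly in `n`. -/
  success_le : ∃ q : ℝ, q < 1 ∧ ∀ᶠ n : ℕ in atTop, ∀ u : ℕ, 1 ≤ u → (u : ℝ) ≤ g * n →
    (Q n).p (n - u) ≤ q

/-! Let `v` be the fraction of uninformed nodes. One round multiplies it in mean by `θ = 1 - p`,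
which is `e^{-ρ}` up to an error `a v`, and the covariance condition keeps its variance below `(1 +
c) v / n`. Errors `a v` accumulated over many rounds must not spoil the rate `e^{-ρ}`, so `v` is
replaced by a potential that absorbs them.

Upper bound: for `Φ(v) = v e^{Kv}` the drop of the exponent from `K v` to `K θ v` pays for `a v`
when `K` is large. Hence `Φ` shrinks in mean by `e^{-ρ}(1 + C/n)` per round (`upper_step`). While a
node is uninformed, `n Φ ≥ 1`, so Markov's inequality gives a geometric tail after `ln n / ρ`
rounds; the factors `1 + C/n` cost only a constant because `ln n ≤ n`.

Lower bound: for `w = v / (1 + K v)` the mean after a round is at least `l w` with `l = e^{-ρ}(1 -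
C/n)`. A first moment does not exclude early completion, so the squared relative shortfall of `w`
below the target `l^t m` is tracked. One round adds only a variance term to its mean (`lower_step`),
and these terms sum to `O(l^{-t} / n)`. At completion the shortfall is 1, so this sum also bounds
the probability of completion by time `t`. -/

/-! ### One-step expectations along a run -/

namespace RumorProcess.IsRun

variable {n : ℕ} {Q : RumorProcess n} {Ω : Type*} [MeasurableSpace Ω] {P : Measure Ω}
  {X : ℕ → Ω → Finset (Fin n)}

/-- The one-step Markov property. -/
theorem measure_eq_and_succ_eq (hX : Q.IsRun P X) (t : ℕ) (S S' : Finset (Fin n)) :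
    P {ω | X t ω = S ∧ X (t + 1) ω = S'} = P {ω | X t ω = S} * Q.step S S' := by
  have hZ : Measurable fun ω (i : Fin t) => X i ω := measurable_pi_lambda _ fun i => hX.measurable i
  -- The chain axiom speaks only of complete histories, so both sides are split over the finitely
  -- many histories before time `t`.
  have key : ∀ A : Set Ω, P A = ∑ h : Fin t → Finset (Fin n),
      P {ω | (∀ i : Fin t, X i ω = h i) ∧ ω ∈ A} := by
    intro A
    have := sum_measure_preimage_singleton (μ := P.restrict A)
      (Finset.univ : Finset (Fin t → Finset (Fin n))) (f := fun ω (i : Fin t) => X i ω)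
      fun y _ => hZ (measurableSet_singleton y)
    simp only [Finset.coe_univ, Set.preimage_univ, Measure.restrict_apply_univ] at this
    rw [← this]
    refine Finset.sum_congr rfl fun h _ => ?_
    rw [Measure.restrict_apply (hZ (measurableSet_singleton h))]
    congr 1
    ext ω
    simp [funext_iff]
  rw [key, key {ω | X t ω = S}, Finset.sum_mul]
  refine Finset.sum_congr rfl fun h _ => ?_
  let h' : ℕ → Finset (Fin n) := fun i => if hi : i < t then h ⟨i, hi⟩ else if i = t then S else S'
  have h't : h' t = S := by simp [h']
  have h't1 : h' (t + 1) = S' := by simp [h']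
  have hlt : ∀ i : Fin t, h' i = h i := fun i => by simp [h']
  have e1 : {ω | ∀ i ≤ t, X i ω = h' i} = {ω | (∀ i : Fin t, X i ω = h i) ∧ ω ∈ {ω | X t ω = S}} := by
    ext ω
    constructor
    · intro H
      exact ⟨fun i => (H i i.2.le).trans (hlt i), (H t le_rfl).trans h't⟩
    · rintro ⟨H, H'⟩ i hi
      rcases hi.lt_or_eq with hi | rfl
      · exact (H ⟨i, hi⟩).trans (hlt ⟨i, hi⟩).symm
      · exact H'.trans h't.symm
  have e2 : {ω | ∀ i ≤ t + 1, X i ω = h' i} =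
      {ω | (∀ i : Fin t, X i ω = h i) ∧ ω ∈ {ω | X t ω = S ∧ X (t + 1) ω = S'}} := by
    ext ω
    constructor
    · intro H
      exact ⟨fun i => (H i (by omega)).trans (hlt i), (H t (by omega)).trans h't,
        (H _ le_rfl).trans h't1⟩
    · rintro ⟨H, H', H''⟩ i hi
      rcases lt_trichotomy i t with hi | rfl | hi
      · exact (H ⟨i, hi⟩).trans (hlt ⟨i, hi⟩).symm
      · exact H'.trans h't.symm
      · obtain rfl : i = t + 1 := by omega
        exact H''.trans h't1.symm
  have := hX.markov t h'
  rwa [e1, e2, h't, h't1] at this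

theorem ae_subset_succ (hX : Q.IsRun P X) (t : ℕ) : ∀ᵐ ω ∂P, X t ω ⊆ X (t + 1) ω := by
  have : ∀ᵐ ω ∂P, ∀ S S' : Finset (Fin n), ¬ S ⊆ S' → ¬ (X t ω = S ∧ X (t + 1) ω = S') := by
    rw [ae_all_iff]
    intro S
    rw [ae_all_iff]
    intro S'
    by_cases h : S ⊆ S'
    · simp [h]
    · simp only [h, not_false_eq_true, forall_const]
      rw [ae_iff]
      simp only [not_not]
      rw [hX.measure_eq_and_succ_eq, mul_eq_zero]
      right
      by_contra h0
      exact h (Q.subset_of_mem_support S S' ((PMF.mem_support_iff _ _).2 h0))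
  filter_upwards [this] with ω hω
  by_contra h
  exact hω _ _ h ⟨rfl, rfl⟩

theorem ae_monotone (hX : Q.IsRun P X) : ∀ᵐ ω ∂P, Monotone fun t => X t ω := by
  filter_upwards [ae_all_iff.2 hX.ae_subset_succ] with ω hω
  exact monotone_nat_of_le_succ hω

theorem integral_succ [IsProbabilityMeasure P] (hX : Q.IsRun P X) (t : ℕ)
    (f : Finset (Fin n) → ℝ) :
    ∫ ω, f (X (t + 1) ω) ∂P
      = ∑ S, P.real {ω | X t ω = S} * ∫ S', f S' ∂(Q.step S).toMeasure := by
  have hm : Measurable fun ω => (X t ω, X (t + 1) ω) := (hX.measurable t).prodMk (hX.measurable _)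
  have : ∫ ω, f (X (t + 1) ω) ∂P = ∫ z, f z.2 ∂(P.map fun ω => (X t ω, X (t + 1) ω)) := by
    rw [integral_map hm.aemeasurable]
    exact AEStronglyMeasurable.of_discrete
  rw [this]
  have := Measure.isProbabilityMeasure_map (μ := P) hm.aemeasurable
  rw [integral_fintype Integrable.of_finite, Fintype.sum_prod_type]
  refine Finset.sum_congr rfl fun S _ => ?_
  rw [PMF.integral_eq_sum, Finset.mul_sum]
  refine Finset.sum_congr rfl fun S' _ => ?_
  have : (P.map fun ω => (X t ω, X (t + 1) ω)).real {(S, S')}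
      = P.real {ω | X t ω = S} * (Q.step S S').toReal := by
    rw [map_measureReal_apply hm (measurableSet_singleton _), measureReal_def, measureReal_def,
      ← ENNReal.toReal_mul, ← hX.measure_eq_and_succ_eq]
    congr 2
    ext ω
    simp
  simp only [this, smul_eq_mul]
  ring

theorem integral_eq_sum [IsProbabilityMeasure P] (hX : Q.IsRun P X) (t : ℕ)
    (f : Finset (Fin n) → ℝ) :
    ∫ ω, f (X t ω) ∂P = ∑ S, P.real {ω | X t ω = S} * f S := by
  have hm := hX.measurable t
  have : ∫ ω, f (X t ω) ∂P = ∫ z, f z ∂(P.map (X t)) := by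
    rw [integral_map hm.aemeasurable]
    exact AEStronglyMeasurable.of_discrete
  rw [this]
  have := Measure.isProbabilityMeasure_map (μ := P) hm.aemeasurable
  rw [integral_fintype Integrable.of_finite]
  refine Finset.sum_congr rfl fun S _ => ?_
  rw [map_measureReal_apply hm (measurableSet_singleton _)]
  rfl

/-- States outside the almost sure invariant `G` carry no mass, so a drift inequality is needed only
on `G`. In the application `G` says that at most `g n` nodes are uninformed. -/
theorem integral_succ_le [IsProbabilityMeasure P] (hX : Q.IsRun P X) (t : ℕ)
    {f g : Finset (Fin n) → ℝ} {G : Finset (Fin n) → Prop} (hG : ∀ᵐ ω ∂P, G (X t ω))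
    (h : ∀ S, G S → ∫ S', f S' ∂(Q.step S).toMeasure ≤ g S) :
    ∫ ω, f (X (t + 1) ω) ∂P ≤ ∫ ω, g (X t ω) ∂P := by
  rw [hX.integral_succ, hX.integral_eq_sum]
  refine Finset.sum_le_sum fun S _ => ?_
  by_cases hS : G S
  · exact mul_le_mul_of_nonneg_left (h S hS) measureReal_nonneg
  · have : P.real {ω | X t ω = S} = 0 := by
      rw [measureReal_def, measure_eq_zero_iff_ae_notMem.2, ENNReal.toReal_zero]
      filter_upwards [hG] with ω hω h'
      exact hS (h' ▸ hω)
    simp [this]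

end RumorProcess.IsRun

/-! ### Mean and variance of the uninformed fraction in one round -/

namespace RumorProcess

variable {n : ℕ}

/-- The fraction of uninformed nodes. -/
noncomputable def uninformedFrac (S : Finset (Fin n)) : ℝ := (Sᶜ.card : ℝ) / n

theorem ae_step_subset (Q : RumorProcess n) (S : Finset (Fin n)) :
    ∀ᵐ S' ∂(Q.step S).toMeasure, S ⊆ S' := by
  rw [ae_iff, PMF.toMeasure_apply_eq_zero_iff _ (MeasurableSet.of_discrete), Set.disjoint_left]
  intro S' h h'
  exact h' (Q.subset_of_mem_support S S' h)

theorem integral_informedIndicator (Q : RumorProcess n) {S : Finset (Fin n)} (hS : S.Nonempty)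
    {x : Fin n} (hx : x ∉ S) :
    ∫ S', informedIndicator x S' ∂(Q.step S).toMeasure = Q.p S.card := by
  rw [← Q.prob_informed S hS x hx]
  have : informedIndicator x = Set.indicator {S' : Finset (Fin n) | x ∈ S'} 1 := by
    ext S'
    by_cases h : x ∈ S' <;> simp [informedIndicator, h]
  rw [this, integral_indicator_one MeasurableSet.of_discrete]

theorem ae_card_compl (Q : RumorProcess n) (S : Finset (Fin n)) :
    ∀ᵐ S' ∂(Q.step S).toMeasure,
      (S'ᶜ.card : ℝ) = Sᶜ.card - (∑ x ∈ Sᶜ, informedIndicator x) S' := by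
  filter_upwards [Q.ae_step_subset S] with S' h
  have h1 : (∑ x ∈ Sᶜ, informedIndicator x) S' = ((Sᶜ.filter (· ∈ S')).card : ℝ) := by
    rw [Finset.sum_apply, Finset.card_filter]
    push_cast
    exact Finset.sum_congr rfl fun x _ => by simp [informedIndicator]
  have h2 : S'ᶜ = Sᶜ.filter (· ∉ S') := by
    ext x
    simp only [Finset.mem_compl, Finset.mem_filter]
    exact ⟨fun hx => ⟨fun h' => hx (h h'), hx⟩, fun hx => hx.2⟩
  rw [h1, h2, ← Finset.card_filter_add_card_filter_not (s := Sᶜ) (· ∈ S')]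
  push_cast
  ring

theorem integral_card_compl (Q : RumorProcess n) {S : Finset (Fin n)} (hS : S.Nonempty) :
    ∫ S', (S'ᶜ.card : ℝ) ∂(Q.step S).toMeasure = Sᶜ.card * (1 - Q.p S.card) := by
  rw [integral_congr_ae (Q.ae_card_compl S), integral_sub Integrable.of_finite Integrable.of_finite]
  simp only [Finset.sum_apply]
  rw [integral_finsetSum _ fun _ _ => Integrable.of_finite,
    Finset.sum_congr rfl fun x hx => Q.integral_informedIndicator hS (Finset.mem_compl.1 hx)]
  simp
  ring

/-- Without a bound, the real supremum in `covNumber` would take its default value 0 and need not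
dominate the individual covariances. -/
theorem bddAbove_covariances (Q : RumorProcess n) (k : ℕ) :
    BddAbove {r : ℝ | ∃ S : Finset (Fin n), S.card = k ∧ ∃ x₁ x₂ : Fin n, x₁ ∉ S ∧ x₂ ∉ S ∧
      x₁ ≠ x₂ ∧ r = covariance (informedIndicator x₁) (informedIndicator x₂)
        (Q.step S).toMeasure} := by
  refine (Set.Finite.subset (Set.finite_range fun z : Finset (Fin n) × Fin n × Fin n =>
    covariance (informedIndicator z.2.1) (informedIndicator z.2.2)
      (Q.step z.1).toMeasure) ?_).bddAbove
  rintro r ⟨S, -, x, y, -, -, -, rfl⟩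
  exact ⟨(S, x, y), rfl⟩

/-- Each row of the covariance matrix of the indicators sums to at most `1 + c`: the diagonal entry
is at most 1, and fewer than `u` other entries are at most `c / u` each, where `u` is the number of
uninformed nodes. -/
theorem variance_card_compl_le (Q : RumorProcess n) {S : Finset (Fin n)} {c : ℝ}
    (hc0 : 0 ≤ c) (hc : Q.covNumber S.card ≤ c / Sᶜ.card) :
    Var[fun S' => (S'ᶜ.card : ℝ); (Q.step S).toMeasure] ≤ (1 + c) * Sᶜ.card := by
  rw [variance_congr (Q.ae_card_compl S), variance_const_sub AEStronglyMeasurable.of_discrete,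
    variance_sum' fun _ _ => MemLp.of_discrete]
  have : ∀ x ∈ Sᶜ, ∑ y ∈ Sᶜ, cov[informedIndicator x, informedIndicator y; (Q.step S).toMeasure]
      ≤ 1 + c := by
    intro x hx
    have hpos : (0 : ℝ) < Sᶜ.card := by exact_mod_cast Finset.card_pos.2 ⟨x, hx⟩
    rw [← Finset.add_sum_erase _ _ hx]
    refine add_le_add ?_ ?_
    · rw [covariance_self AEMeasurable.of_discrete]
      refine (variance_le_sq_of_bounded (a := 0) (b := 1) (.of_forall fun S' => ?_)
        AEMeasurable.of_discrete).trans (by norm_num)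
      by_cases h : x ∈ S' <;> simp [informedIndicator, h]
    · calc _ ≤ ∑ y ∈ Sᶜ.erase x, c / Sᶜ.card := by
            refine Finset.sum_le_sum fun y hy => le_trans ?_ hc
            rw [Finset.mem_erase, Finset.mem_compl] at hy
            exact le_csSup (Q.bddAbove_covariances _)
              ⟨S, rfl, x, y, Finset.mem_compl.1 hx, hy.2, hy.1.symm, rfl⟩
        _ ≤ ∑ y ∈ Sᶜ, c / Sᶜ.card :=
            Finset.sum_le_sum_of_subset_of_nonneg (Finset.erase_subset _ _) fun _ _ _ => by
              positivity
        _ = c := by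
            rw [Finset.sum_const, nsmul_eq_mul]
            field_simp
  refine (Finset.sum_le_sum this).trans_eq ?_
  rw [Finset.sum_const, nsmul_eq_mul, mul_comm]

theorem uninformedFrac_nonneg (S : Finset (Fin n)) : 0 ≤ uninformedFrac S := by
  unfold uninformedFrac
  positivity

theorem uninformedFrac_le_one (S : Finset (Fin n)) : uninformedFrac S ≤ 1 := by
  unfold uninformedFrac
  refine div_le_one_of_le₀ ?_ (by positivity)
  exact_mod_cast (Finset.card_le_univ _).trans_eq (Fintype.card_fin n)

theorem integral_uninformedFrac (Q : RumorProcess n) {S : Finset (Fin n)} (hS : S.Nonempty) :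
    ∫ S', uninformedFrac S' ∂(Q.step S).toMeasure = (1 - Q.p S.card) * uninformedFrac S := by
  unfold uninformedFrac
  rw [integral_div, Q.integral_card_compl hS]
  ring

theorem variance_uninformedFrac_le (Q : RumorProcess n) {S : Finset (Fin n)} {c : ℝ}
    (hc0 : 0 ≤ c) (hc : Q.covNumber S.card ≤ c / Sᶜ.card) :
    Var[uninformedFrac; (Q.step S).toMeasure] ≤ (1 + c) * uninformedFrac S / n := by
  have : (uninformedFrac : Finset (Fin n) → ℝ) = fun S' => (1 / n : ℝ) * (S'ᶜ.card : ℝ) := by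
    ext S'
    unfold uninformedFrac
    ring
  rw [this, variance_const_mul]
  calc _ ≤ (1 / n : ℝ) ^ 2 * ((1 + c) * Sᶜ.card) := by
        gcongr
        exact Q.variance_card_compl_le hc0 hc
    _ = _ := by ring

end RumorProcess

/-! ### Quadratic estimates for the two potentials -/

/-- For `|s| ≤ 1` this is Taylor's bound. Otherwise `s ^ 2 ≥ 1`, so `e^K s ^ 2` alone dominates
`e^s`, and `1 + s + s ^ 2 ≥ 0`. -/
theorem Real.exp_le_one_add_add_sq {K s : ℝ} (hs : s ≤ K) :
    Real.exp s ≤ 1 + s + (1 + Real.exp K) * s ^ 2 := by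
  have hK := Real.exp_pos K
  rcases le_or_gt |s| 1 with h | h
  · have h1 := (abs_le.1 (Real.abs_exp_sub_one_sub_id_le h)).2
    nlinarith [mul_nonneg hK.le (sq_nonneg s)]
  · have h1 : 1 ≤ s ^ 2 := by rw [← sq_abs]; nlinarith
    have h2 := Real.exp_le_exp.2 hs
    nlinarith [sq_nonneg (s + 1), sq_nonneg (2 * s + 1)]

/-- An expansion around `x` that is used with `x` the mean of `y`: the linear term then integrates
to zero and the quadratic term becomes a variance. -/
theorem mul_exp_le_quadratic {K x y : ℝ} (hK : 0 ≤ K) (hx : 0 ≤ x) (hy0 : 0 ≤ y) (hy1 : y ≤ 1) :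
    y * Real.exp (K * y) ≤ Real.exp (K * x) *
      (y + K * x * (y - x) + (K + (1 + Real.exp K) * K ^ 2) * (y - x) ^ 2) := by
  have h1 : Real.exp (K * y) = Real.exp (K * x) * Real.exp (K * (y - x)) := by
    rw [← Real.exp_add]
    ring_nf
  have h2 : Real.exp (K * (y - x)) ≤ 1 + K * (y - x) + (1 + Real.exp K) * (K * (y - x)) ^ 2 :=
    Real.exp_le_one_add_add_sq (by nlinarith)
  have h3 : 0 ≤ (1 + Real.exp K) * (K * (y - x)) ^ 2 := by positivity
  rw [h1, mul_left_comm]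
  gcongr
  calc y * Real.exp (K * (y - x))
      ≤ y * (1 + K * (y - x) + (1 + Real.exp K) * (K * (y - x)) ^ 2) := by gcongr
    _ ≤ _ := by nlinarith

section OneStep

variable {α : Type*} [MeasurableSpace α] [Finite α] [DiscreteMeasurableSpace α] {π : Measure α}
  [IsProbabilityMeasure π] {V : α → ℝ}

theorem integral_mul_exp_le {K : ℝ} (hK : 0 ≤ K) (hV0 : ∀ s, 0 ≤ V s) (hV1 : ∀ s, V s ≤ 1) :
    ∫ s, V s * Real.exp (K * V s) ∂π ≤ Real.exp (K * ∫ s, V s ∂π) *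
      (∫ s, V s ∂π + (K + (1 + Real.exp K) * K ^ 2) * Var[V; π]) := by
  rw [variance_eq_integral AEMeasurable.of_discrete]
  set x := ∫ s, V s ∂π with hx
  have hx0 : 0 ≤ x := integral_nonneg hV0
  refine (integral_mono Integrable.of_finite Integrable.of_finite fun s =>
    mul_exp_le_quadratic hK hx0 (hV0 s) (hV1 s)).trans_eq ?_
  rw [integral_const_mul, integral_add Integrable.of_finite Integrable.of_finite,
    integral_add Integrable.of_finite Integrable.of_finite, integral_const_mul,
    integral_const_mul, integral_sub Integrable.of_finite Integrable.of_finite, ← hx]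
  simp

/-- The function `v ↦ v / (1 + K v)`. -/
noncomputable def damp (K v : ℝ) : ℝ := v / (1 + K * v)

theorem damp_nonneg {K v : ℝ} (hK : 0 ≤ K) (hv : 0 ≤ v) : 0 ≤ damp K v := by
  unfold damp
  positivity

theorem le_mul_damp {K v : ℝ} (hK : 0 ≤ K) (hv : 0 ≤ v) (hv1 : v ≤ 1) :
    v ≤ (1 + K) * damp K v := by
  unfold damp
  rw [← mul_div_assoc, le_div_iff₀ (by positivity)]
  nlinarith [mul_nonneg hK hv]

theorem abs_damp_sub_damp_le {K x y : ℝ} (hK : 0 ≤ K) (hx : 0 ≤ x) (hy : 0 ≤ y) :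
    |damp K y - damp K x| ≤ |y - x| := by
  have hKx := mul_nonneg hK hx
  have hKy := mul_nonneg hK hy
  have : damp K y - damp K x = (y - x) / ((1 + K * y) * (1 + K * x)) := by
    unfold damp
    field_simp
    ring
  rw [this, abs_div]
  refine div_le_self (abs_nonneg _) ?_
  rw [abs_of_pos (by positivity)]
  nlinarith [mul_nonneg hKx hKy]

/-- The gap below the tangent at `x` is exactly `K (y - x)^2 / ((1 + K x)^2 (1 + K y))`, so the loss
in Jensen's inequality is at most `K` times the variance. -/
theorem le_damp {K x y : ℝ} (hK : 0 ≤ K) (hx : 0 ≤ x) (hy : 0 ≤ y) :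
    damp K x + (y - x) / (1 + K * x) ^ 2 - K * (y - x) ^ 2 ≤ damp K y := by
  have hKx := mul_nonneg hK hx
  have hKy := mul_nonneg hK hy
  have : damp K y - (damp K x + (y - x) / (1 + K * x) ^ 2)
      = - (K * (y - x) ^ 2 / ((1 + K * x) ^ 2 * (1 + K * y))) := by
    unfold damp
    field_simp
    ring
  have h2 : K * (y - x) ^ 2 / ((1 + K * x) ^ 2 * (1 + K * y)) ≤ K * (y - x) ^ 2 := by
    refine div_le_self (by positivity) ?_
    exact one_le_mul_of_one_le_of_one_le (one_le_pow₀ (by linarith)) (by linarith)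
  linarith

theorem damp_le_integral_damp {K : ℝ} (hK : 0 ≤ K) (hV0 : ∀ s, 0 ≤ V s) :
    damp K (∫ s, V s ∂π) - K * Var[V; π] ≤ ∫ s, damp K (V s) ∂π := by
  rw [variance_eq_integral AEMeasurable.of_discrete]
  set x := ∫ s, V s ∂π with hx
  have hx0 : 0 ≤ x := integral_nonneg hV0
  refine le_of_eq_of_le ?_ (integral_mono Integrable.of_finite Integrable.of_finite fun s =>
    le_damp hK hx0 (hV0 s))
  rw [integral_sub Integrable.of_finite Integrable.of_finite,
    integral_add Integrable.of_finite Integrable.of_finite, integral_const_mul,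
    integral_div, integral_sub Integrable.of_finite Integrable.of_finite, ← hx]
  simp

/-- The variance is at most the second moment about the damped mean, and damping is 1-Lipschitz. -/
theorem variance_damp_le {K : ℝ} (hK : 0 ≤ K) (hV0 : ∀ s, 0 ≤ V s) :
    Var[fun s => damp K (V s); π] ≤ Var[V; π] := by
  rw [← variance_sub_const AEStronglyMeasurable.of_discrete (damp K (∫ s, V s ∂π))]
  refine (variance_le_expectation_sq AEStronglyMeasurable.of_discrete).trans ?_
  rw [variance_eq_integral AEMeasurable.of_discrete]
  refine integral_mono Integrable.of_finite Integrable.of_finite fun s => ?_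
  exact sq_le_sq.2 (abs_damp_sub_damp_le hK (integral_nonneg hV0) (hV0 s))

/-- The squared relative shortfall of `w` below the target `m`. -/
noncomputable def shortfall (m w : ℝ) : ℝ := (max (1 - w / m) 0) ^ 2

/-- The function `s ↦ max(s, 0)^2` has the 2-Lipschitz derivative `2 max(s, 0)`, so its tangent at
any point errs by at most the squared distance. -/
theorem shortfall_le_quadratic {m x y : ℝ} :
    shortfall m y ≤ shortfall m x - 2 * max (1 - x / m) 0 * ((y - x) / m) + ((y - x) / m) ^ 2 := by
  unfold shortfall
  have : (y - x) / m = (1 - x / m) - (1 - y / m) := by ring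
  rw [this]
  generalize 1 - x / m = s
  generalize 1 - y / m = t
  rcases max_cases s 0 with ⟨h, hs⟩ | ⟨h, hs⟩ <;>
    rcases max_cases t 0 with ⟨h', ht⟩ | ⟨h', ht⟩ <;> rw [h, h']
  · nlinarith
  · nlinarith [sq_nonneg t]
  · nlinarith [sq_nonneg s, mul_nonneg (neg_nonneg.2 hs.le) ht]
  · nlinarith [sq_nonneg (s - t)]

theorem integral_shortfall_le_add_variance {G : α → ℝ} {m : ℝ} :
    ∫ s, shortfall m (G s) ∂π ≤ shortfall m (∫ s, G s ∂π) + Var[G; π] / m ^ 2 := by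
  rw [variance_eq_integral AEMeasurable.of_discrete]
  set x := ∫ s, G s ∂π with hx
  refine (integral_mono Integrable.of_finite Integrable.of_finite fun s =>
    shortfall_le_quadratic (x := x)).trans_eq ?_
  simp only [div_pow]
  rw [integral_add Integrable.of_finite Integrable.of_finite,
    integral_sub Integrable.of_finite Integrable.of_finite, integral_const_mul,
    integral_div, integral_div, integral_sub Integrable.of_finite Integrable.of_finite, ← hx]
  simp

theorem shortfall_antitone {m w w' : ℝ} (hm : 0 < m) (h : w ≤ w') :
    shortfall m w' ≤ shortfall m w := by
  unfold shortfall
  gcongr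

theorem shortfall_self {m : ℝ} (hm : 0 < m) : shortfall m m = 0 := by
  simp [shortfall, hm.ne']

/-- If the mean `x` is below the new target `l m`, then `w ≤ m`, and the relative shortfall of `x`
is no larger than that of `w`. If `x` is above, raising the target to `x` leaves only variance, and
`x ^ 2 ≥ (l w)(l m)` bounds it by the same term. -/
theorem integral_shortfall_le {G : α → ℝ} {m w l σ : ℝ} (hm : 0 < m) (hw : 0 < w) (hl : 0 < l)
    (hσ : 0 ≤ σ) (hG0 : ∀ s, 0 ≤ G s) (hG : l * w ≤ ∫ s, G s ∂π) (hvar : Var[G; π] ≤ σ * w) :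
    ∫ s, shortfall (l * m) (G s) ∂π ≤ shortfall m w + σ / (l ^ 2 * m) := by
  set x := ∫ s, G s ∂π with hx
  have hx0 : 0 < x := lt_of_lt_of_le (by positivity) hG
  rcases le_total x (l * m) with h | h
  · refine integral_shortfall_le_add_variance.trans (add_le_add ?_ ?_)
    · rw [← hx]
      refine (shortfall_antitone (by positivity) hG).trans_eq ?_
      unfold shortfall
      rw [mul_div_mul_left _ _ hl.ne']
    · have hwm : w ≤ m := le_of_mul_le_mul_left (hG.trans h) hl
      calc _ ≤ σ * m / (l * m) ^ 2 := by
            gcongr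
            exact hvar.trans (by gcongr)
        _ = _ := by field_simp
  · calc _ ≤ ∫ s, shortfall x (G s) ∂π := by
          refine integral_mono Integrable.of_finite Integrable.of_finite fun s => ?_
          unfold shortfall
          have := hG0 s
          gcongr
      _ ≤ shortfall x x + Var[G; π] / x ^ 2 := integral_shortfall_le_add_variance
      _ ≤ 0 + σ * w / x ^ 2 := by
          rw [shortfall_self hx0]
          gcongr
      _ ≤ 0 + σ / (l ^ 2 * m) := by
          gcongr 0 + ?_
          rw [div_le_div_iff₀ (by positivity) (by positivity)]
          calc σ * w * (l ^ 2 * m) = σ * ((l * w) * (l * m)) := by ring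
            _ ≤ σ * (x * x) := by gcongr
            _ = σ * x ^ 2 := by ring
      _ ≤ _ := by
          gcongr
          exact sq_nonneg _

end OneStep

/-! ### Drift of the potentials in one round -/

namespace RumorProcess

variable {n : ℕ}

theorem uninformedFrac_univ : uninformedFrac (Finset.univ : Finset (Fin n)) = 0 := by
  simp [uninformedFrac]

theorem integral_step_univ (Q : RumorProcess n) (f : Finset (Fin n) → ℝ) :
    ∫ S', f S' ∂(Q.step Finset.univ).toMeasure = f Finset.univ := by
  have : ∀ᵐ S' ∂(Q.step Finset.univ).toMeasure, f S' = f Finset.univ := by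
    filter_upwards [Q.ae_step_subset Finset.univ] with S' h
    rw [Finset.univ_subset_iff.1 h]
  rw [integral_congr_ae this]
  simp

theorem card_eq_sub (S : Finset (Fin n)) : S.card = n - Sᶜ.card := by
  rw [Finset.card_compl, Fintype.card_fin]
  have := (Finset.card_le_univ S).trans_eq (Fintype.card_fin n)
  omega

theorem nonempty_of_card_compl_lt {S : Finset (Fin n)} (h : Sᶜ.card < n) : S.Nonempty := by
  rw [← Finset.card_pos, card_eq_sub]
  omega

theorem card_compl_lt {S : Finset (Fin n)} {g : ℝ} (hg : g < 1) (hn : 0 < n)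
    (h : (Sᶜ.card : ℝ) ≤ g * n) : Sᶜ.card < n := by
  have hn' : (0 : ℝ) < n := by exact_mod_cast hn
  have h' : (Sᶜ.card : ℝ) < n := h.trans_lt (by nlinarith)
  exact_mod_cast h'

theorem stay_nonneg {S : Finset (Fin n)} (Q : RumorProcess n) (hn : 0 < n)
    (hS : S.Nonempty) (hS' : S ≠ Finset.univ) : 0 ≤ 1 - Q.p S.card := by
  have hpos : 0 < uninformedFrac S := by
    have : 0 < Sᶜ.card := by
      rw [Finset.card_pos, Finset.nonempty_iff_ne_empty]
      simpa using hS'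
    unfold uninformedFrac
    positivity
  have h1 : 0 ≤ ∫ S', uninformedFrac S' ∂(Q.step S).toMeasure :=
    integral_nonneg uninformedFrac_nonneg
  rw [Q.integral_uninformedFrac hS] at h1
  exact nonneg_of_mul_nonneg_left h1 hpos

/-- The choice of `K` gives `θ ≤ e^{-ρ}(1 + K (1 - θ) v) ≤ e^{-ρ} e^{K(1-θ)v}`, which is the
contraction at the mean. The variance contributes the relative error of order `1 / n`. -/
theorem upper_step (Q : RumorProcess n) {ρ g a c q K ρ₁ : ℝ} (hg : g < 1)
    (ha : 0 ≤ a) (hc : 0 ≤ c) (hK : 0 ≤ K) (hKq : a * Real.exp ρ₁ ≤ K * (1 - q)) (hρ : ρ ≤ ρ₁)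
    (hstay : ∀ u : ℕ, 1 ≤ u → (u : ℝ) ≤ g * n → 1 - Q.p (n - u) ≤ Real.exp (-ρ) + a * (u / n))
    (hcov : ∀ u : ℕ, 1 ≤ u → (u : ℝ) ≤ g * n → Q.covNumber (n - u) ≤ c / u)
    (hq : Real.exp (-ρ) + a * g ≤ q) (S : Finset (Fin n)) (hS : (Sᶜ.card : ℝ) ≤ g * n) :
    ∫ S', uninformedFrac S' * Real.exp (K * uninformedFrac S') ∂(Q.step S).toMeasure ≤
      (Real.exp (-ρ) *
        (1 + (K + (1 + Real.exp K) * K ^ 2) * (1 + c) * Real.exp ρ₁ / n)) *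
        (uninformedFrac S * Real.exp (K * uninformedFrac S)) := by
  by_cases hU : S = Finset.univ
  · subst hU
    rw [Q.integral_step_univ, uninformedFrac_univ]
    simp
  have hu : 1 ≤ Sᶜ.card := by
    rw [Nat.one_le_iff_ne_zero, Finset.card_ne_zero, Finset.nonempty_iff_ne_empty]
    simpa using hU
  have hn : 0 < n := by
    have := (Finset.card_le_univ Sᶜ).trans_eq (Fintype.card_fin n)
    omega
  have hn' : (0 : ℝ) < n := by exact_mod_cast hn
  have hne : S.Nonempty := nonempty_of_card_compl_lt (card_compl_lt hg hn hS)
  have hst := hstay _ hu hS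
  have hcv := hcov _ hu hS
  rw [← card_eq_sub] at hst hcv
  have hvar := Q.variance_uninformedFrac_le hc hcv
  have hth0 := Q.stay_nonneg hn hne hU
  have hmean := Q.integral_uninformedFrac hne
  refine (integral_mul_exp_le hK uninformedFrac_nonneg uninformedFrac_le_one).trans ?_
  rw [hmean]
  change _ ≤ Real.exp (-ρ) + a * uninformedFrac S at hst
  have hvg : uninformedFrac S ≤ g := by
    unfold uninformedFrac
    rwa [div_le_iff₀ hn']
  have hv0 : 0 ≤ uninformedFrac S := uninformedFrac_nonneg S
  set θ := 1 - Q.p S.card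
  set v := uninformedFrac S
  set M := K + (1 + Real.exp K) * K ^ 2
  have hM : 0 ≤ M := by positivity
  have hθq : θ ≤ q := hst.trans (le_trans (by gcongr) hq)
  have hE := Real.exp_pos (-ρ)
  have hexp : 1 ≤ Real.exp (-ρ) * Real.exp ρ₁ := by
    rw [← Real.exp_add]
    exact Real.one_le_exp (by linarith)
  have h1 : Real.exp (K * (θ * v)) * (θ * v) ≤ Real.exp (-ρ) * (v * Real.exp (K * v)) := by
    have h2 : Real.exp (K * v) = Real.exp (K * (θ * v)) * Real.exp (K * (1 - θ) * v) := by
      rw [← Real.exp_add]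
      ring_nf
    have h3 : θ ≤ Real.exp (-ρ) * Real.exp (K * (1 - θ) * v) := by
      calc θ ≤ Real.exp (-ρ) + (a * v) * 1 := by linarith
        _ ≤ Real.exp (-ρ) + (a * v) * (Real.exp (-ρ) * Real.exp ρ₁) := by gcongr
        _ = Real.exp (-ρ) * (a * Real.exp ρ₁ * v + 1) := by ring
        _ ≤ Real.exp (-ρ) * (K * (1 - θ) * v + 1) := by
            have h5 : a * Real.exp ρ₁ ≤ K * (1 - θ) := hKq.trans (by gcongr)
            gcongr
        _ ≤ _ := by
            gcongr
            exact Real.add_one_le_exp _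
    rw [h2]
    calc _ = (Real.exp (K * (θ * v)) * v) * θ := by ring
      _ ≤ (Real.exp (K * (θ * v)) * v) * (Real.exp (-ρ) * Real.exp (K * (1 - θ) * v)) := by gcongr
      _ = _ := by ring
  have hθ1 : θ ≤ 1 := by
    have hp : 0 ≤ Q.p S.card := by
      obtain ⟨x, hx⟩ := Finset.card_pos.1 hu
      rw [← Q.prob_informed S hne x (Finset.mem_compl.1 hx)]
      exact measureReal_nonneg
    linarith
  have h4 : Real.exp (K * (θ * v)) ≤ Real.exp (K * v) := by
    gcongr
    nlinarith
  calc _ ≤ Real.exp (K * (θ * v)) * (θ * v + M * ((1 + c) * v / n)) := by gcongr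
    _ = Real.exp (K * (θ * v)) * (θ * v) + Real.exp (K * (θ * v)) * (M * ((1 + c) * v / n)) * 1 := by
        ring
    _ ≤ Real.exp (-ρ) * (v * Real.exp (K * v)) + Real.exp (K * v) * (M * ((1 + c) * v / n)) *
        (Real.exp (-ρ) * Real.exp ρ₁) := by gcongr
    _ = _ := by ring

/-- Clearing denominators, `e^{-ρ} damp(v) ≤ damp(θ v)` amounts to `e^{-ρ} ≤ θ + K θ v (1 -
e^{-ρ})`, which holds since `θ ≥ 1 - q` makes the last term at least `a v`. The Jensen loss is
proportional to `damp(v) / n` and is absorbed in `l`. -/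
theorem lower_step (Q : RumorProcess n) {ρ g a c q K ρ₀ ρ₁ l m : ℝ} (hg : g < 1)
    (hc : 0 ≤ c) (hK : 0 ≤ K)
    (hKq : a ≤ K * (1 - q) * (1 - Real.exp (-ρ₀))) (hρ₀ : 0 < ρ₀) (hρ : ρ₀ ≤ ρ) (hρ' : ρ ≤ ρ₁)
    (hstay : ∀ u : ℕ, 1 ≤ u → (u : ℝ) ≤ g * n → Real.exp (-ρ) - a * (u / n) ≤ 1 - Q.p (n - u))
    (hcov : ∀ u : ℕ, 1 ≤ u → (u : ℝ) ≤ g * n → Q.covNumber (n - u) ≤ c / u)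
    (hq : ∀ u : ℕ, 1 ≤ u → (u : ℝ) ≤ g * n → Q.p (n - u) ≤ q) (hm : 0 < m) (hl0 : 0 < l)
    (hl : l = Real.exp (-ρ) * (1 - K * ((1 + c) * (1 + K)) * Real.exp ρ₁ / n))
    (S : Finset (Fin n)) (hS : (Sᶜ.card : ℝ) ≤ g * n) :
    ∫ S', shortfall (l * m) (damp K (uninformedFrac S')) ∂(Q.step S).toMeasure ≤
      shortfall m (damp K (uninformedFrac S)) + ((1 + c) * (1 + K) / n) / (l ^ 2 * m) := by
  by_cases hU : S = Finset.univ
  · subst hU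
    rw [Q.integral_step_univ, uninformedFrac_univ]
    have : shortfall (l * m) (damp K 0) = shortfall m (damp K 0) := by simp [shortfall, damp]
    rw [this]
    simp only [le_add_iff_nonneg_right]
    positivity
  have hu : 1 ≤ Sᶜ.card := by
    rw [Nat.one_le_iff_ne_zero, Finset.card_ne_zero, Finset.nonempty_iff_ne_empty]
    simpa using hU
  have hn : 0 < n := by
    have := (Finset.card_le_univ Sᶜ).trans_eq (Fintype.card_fin n)
    omega
  have hn' : (0 : ℝ) < n := by exact_mod_cast hn
  have hne : S.Nonempty := nonempty_of_card_compl_lt (card_compl_lt hg hn hS)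
  have hst := hstay _ hu hS
  have hcv := hcov _ hu hS
  have hq' := hq _ hu hS
  rw [← card_eq_sub] at hst hcv hq'
  have hvar := Q.variance_uninformedFrac_le hc hcv
  have hth0 := Q.stay_nonneg hn hne hU
  have hmean := Q.integral_uninformedFrac hne
  change Real.exp (-ρ) - a * uninformedFrac S ≤ _ at hst
  have hv0 : 0 < uninformedFrac S := by
    unfold uninformedFrac
    positivity
  have hv1 : uninformedFrac S ≤ 1 := uninformedFrac_le_one S
  have hθq : 1 - q ≤ 1 - Q.p S.card := by linarith
  have hw := le_mul_damp hK hv0.le hv1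
  have hvar' : Var[uninformedFrac; (Q.step S).toMeasure] ≤
      (1 + c) * (1 + K) / n * damp K (uninformedFrac S) := by
    refine hvar.trans ?_
    calc _ ≤ (1 + c) * ((1 + K) * damp K (uninformedFrac S)) / n := by gcongr
      _ = _ := by ring
  have hw0 : 0 < damp K (uninformedFrac S) := by
    unfold damp
    positivity
  refine integral_shortfall_le hm hw0 hl0 (by positivity)
    (fun S' => damp_nonneg hK (uninformedFrac_nonneg S')) ?_
    ((variance_damp_le hK uninformedFrac_nonneg).trans hvar')
  refine le_trans ?_ (damp_le_integral_damp hK uninformedFrac_nonneg)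
  rw [hmean]
  set θ := 1 - Q.p S.card
  set v := uninformedFrac S
  have hexp : 1 ≤ Real.exp (-ρ) * Real.exp ρ₁ := by
    rw [← Real.exp_add]
    exact Real.one_le_exp (by linarith)
  have hE0 : Real.exp (-ρ) ≤ Real.exp (-ρ₀) := Real.exp_le_exp.2 (by linarith)
  have hE1 : Real.exp (-ρ₀) < 1 := by simpa using hρ₀
  have h1 : Real.exp (-ρ) * damp K v ≤ damp K (θ * v) := by
    unfold damp
    rw [← mul_div_assoc, div_le_div_iff₀ (by positivity) (by positivity)]
    have h2 : a * v ≤ K * θ * (1 - Real.exp (-ρ)) * v := by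
      refine mul_le_mul_of_nonneg_right (hKq.trans ?_) hv0.le
      have : 0 ≤ 1 - Real.exp (-ρ₀) := by linarith
      gcongr
    nlinarith
  have hw1 : 0 ≤ K * ((1 + c) * (1 + K) / n * damp K v) := by positivity
  calc l * damp K v = Real.exp (-ρ) * damp K v -
        (Real.exp (-ρ) * Real.exp ρ₁) * (K * ((1 + c) * (1 + K) / n * damp K v)) := by
        rw [hl]
        ring
    _ ≤ damp K (θ * v) - 1 * (K * ((1 + c) * (1 + K) / n * damp K v)) := by gcongr
    _ ≤ damp K (θ * v) - K * Var[uninformedFrac; (Q.step S).toMeasure] := by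
        rw [one_mul]
        gcongr

end RumorProcess

/-! ### Iteration over the rounds -/

namespace RumorProcess.IsRun

variable {n : ℕ} {Q : RumorProcess n} {Ω : Type*} [MeasurableSpace Ω] {P : Measure Ω}
  {X : ℕ → Ω → Finset (Fin n)}

theorem ae_card_compl_le (hX : Q.IsRun P X) {u : ℕ} {b : ℝ} (hb : (u : ℝ) ≤ b) (hu : u ≤ n)
    (h0 : ∀ᵐ ω ∂P, (X 0 ω).card = n - u) (t : ℕ) : ∀ᵐ ω ∂P, ((X t ω)ᶜ.card : ℝ) ≤ b := by
  filter_upwards [h0, hX.ae_monotone] with ω h hmono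
  have h1 := Finset.card_le_card (hmono (Nat.zero_le t))
  have h2 : (X t ω)ᶜ.card ≤ u := by
    rw [Finset.card_compl, Fintype.card_fin]
    simp only at h1
    omega
  exact le_trans (by exact_mod_cast h2) hb

theorem integrable_comp [IsProbabilityMeasure P] (hX : Q.IsRun P X) (t : ℕ)
    (f : Finset (Fin n) → ℝ) : Integrable (fun ω => f (X t ω)) P := by
  have := Measure.isProbabilityMeasure_map (μ := P) (hX.measurable t).aemeasurable
  exact (Integrable.of_finite (μ := P.map (X t)) (f := f)).comp_measurable (hX.measurable t)

theorem measurableSet_comp (hX : Q.IsRun P X) (t : ℕ) (p : Finset (Fin n) → Prop) :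
    MeasurableSet {ω | p (X t ω)} :=
  hX.measurable t (MeasurableSet.of_discrete (s := {S | p S}))

theorem measureReal_le_integral [IsProbabilityMeasure P] (hX : Q.IsRun P X) (t : ℕ)
    {f : Finset (Fin n) → ℝ} (hf : ∀ S, 0 ≤ f S) {p : Finset (Fin n) → Prop}
    (hp : ∀ S, p S → 1 ≤ f S) : P.real {ω | p (X t ω)} ≤ ∫ ω, f (X t ω) ∂P := by
  rw [← integral_indicator_one (hX.measurableSet_comp t p)]
  refine integral_mono_of_nonneg (.of_forall fun ω => ?_) (hX.integrable_comp t f)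
    (.of_forall fun ω => ?_)
  · exact Set.indicator_nonneg (fun _ _ => zero_le_one) _
  · exact Set.indicator_apply_le' (fun h => hp _ h) fun _ => hf _

theorem measureReal_card_lt_le [IsProbabilityMeasure P] (hX : Q.IsRun P X)
    {G : Finset (Fin n) → Prop} (hG : ∀ t, ∀ᵐ ω ∂P, G (X t ω)) {K l : ℝ} (hK : 0 ≤ K) (hl : 0 ≤ l)
    (hstep : ∀ S, G S →
      ∫ S', uninformedFrac S' * Real.exp (K * uninformedFrac S') ∂(Q.step S).toMeasure ≤
        l * (uninformedFrac S * Real.exp (K * uninformedFrac S))) (t : ℕ) :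
    P.real {ω | (X t ω).card < n} ≤ n * Real.exp K * l ^ t := by
  have main : ∀ t, ∫ ω, uninformedFrac (X t ω) * Real.exp (K * uninformedFrac (X t ω)) ∂P
      ≤ Real.exp K * l ^ t := by
    intro t
    induction t with
    | zero =>
      rw [pow_zero, mul_one]
      refine (integral_mono (hX.integrable_comp 0 fun S => uninformedFrac S *
        Real.exp (K * uninformedFrac S)) (integrable_const (Real.exp K)) fun ω => ?_).trans_eq
          (by simp)
      have h0 := uninformedFrac_nonneg (X 0 ω)
      have h1 := uninformedFrac_le_one (X 0 ω)
      calc _ ≤ 1 * Real.exp (K * 1) := by gcongr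
        _ = _ := by simp
    | succ t ih =>
      refine (hX.integral_succ_le t (f := fun S => uninformedFrac S *
        Real.exp (K * uninformedFrac S)) (hG t) hstep).trans ?_
      rw [integral_const_mul, pow_succ]
      calc _ ≤ l * (Real.exp K * l ^ t) := by gcongr
        _ = _ := by ring
  calc _ ≤ ∫ ω, n * (uninformedFrac (X t ω) * Real.exp (K * uninformedFrac (X t ω))) ∂P := by
        refine hX.measureReal_le_integral t
          (f := fun S => n * (uninformedFrac S * Real.exp (K * uninformedFrac S)))
          (p := fun S => S.card < n) (fun S => ?_) (fun S hS => ?_)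
        · have := uninformedFrac_nonneg S
          positivity
        · have h1 : (1 : ℝ) ≤ Sᶜ.card := by
            rw [Finset.card_compl, Fintype.card_fin]
            exact_mod_cast (by omega : 1 ≤ n - S.card)
          have hn : (0 : ℝ) < n := by exact_mod_cast (Nat.zero_le _).trans_lt hS
          have h2 : n * uninformedFrac S = Sᶜ.card := by
            unfold uninformedFrac
            field_simp
          have h3 : 1 ≤ Real.exp (K * uninformedFrac S) :=
            Real.one_le_exp (mul_nonneg hK (uninformedFrac_nonneg S))
          rw [← mul_assoc, h2]
          exact one_le_mul_of_one_le_of_one_le h1 h3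
    _ ≤ n * (Real.exp K * l ^ t) := by
        rw [integral_const_mul]
        have := main t
        gcongr
    _ = _ := by ring

theorem measureReal_le_card_le [IsProbabilityMeasure P] (hX : Q.IsRun P X)
    {G : Finset (Fin n) → Prop} (hG : ∀ t, ∀ᵐ ω ∂P, G (X t ω)) {K l m σ B v₀ : ℝ}
    (hl : 0 < l) (hm : 0 < m) (hv₀ : m = damp K v₀)
    (h0 : ∀ᵐ ω ∂P, uninformedFrac (X 0 ω) = v₀)
    (hB0 : 0 ≤ B) (hB : σ ≤ B * ((1 - l) * l * m))
    (hstep : ∀ m, 0 < m → ∀ S, G S →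
      ∫ S', shortfall (l * m) (damp K (uninformedFrac S')) ∂(Q.step S).toMeasure ≤
      shortfall m (damp K (uninformedFrac S)) + (σ / n) / (l ^ 2 * m)) (t : ℕ) :
    P.real {ω | n ≤ (X t ω).card} ≤ B / n / l ^ t := by
  have main : ∀ t, ∫ ω, shortfall (l ^ t * m) (damp K (uninformedFrac (X t ω))) ∂P
      ≤ B / n / l ^ t := by
    intro t
    induction t with
    | zero =>
      have : ∀ᵐ ω ∂P, shortfall (l ^ 0 * m) (damp K (uninformedFrac (X 0 ω))) = 0 := by
        filter_upwards [h0] with ω h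
        rw [h, ← hv₀, pow_zero, one_mul, shortfall_self hm]
      rw [integral_congr_ae this]
      simp
      positivity
    | succ t ih =>
      have hlt : 0 < l ^ t * m := by positivity
      have e : l ^ (t + 1) * m = l * (l ^ t * m) := by ring
      rw [e]
      refine (hX.integral_succ_le t (f := fun S => shortfall (l * (l ^ t * m))
        (damp K (uninformedFrac S))) (hG t) (hstep _ hlt)).trans ?_
      rw [integral_add (hX.integrable_comp t fun S => shortfall (l ^ t * m)
        (damp K (uninformedFrac S))) (integrable_const _)]
      simp only [integral_const, probReal_univ, one_smul]
      -- By the choice of `B` the increment telescopes: it is at most `(B / n)(l^{-(t+1)} -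
      -- l^{-t})`.
      calc _ ≤ B / n / l ^ t + (B * ((1 - l) * l * m)) / n / (l ^ 2 * (l ^ t * m)) := by gcongr
        _ = _ := by
          rw [pow_succ]
          by_cases hn : (n : ℝ) = 0
          · simp [hn]
          field_simp
          ring
  refine le_trans ?_ (main t)
  refine hX.measureReal_le_integral t
    (f := fun S => shortfall (l ^ t * m) (damp K (uninformedFrac S)))
    (p := fun S => n ≤ S.card) (fun S => sq_nonneg _) (fun S hS => ?_)
  have : S = Finset.univ := by
    rw [← Finset.card_eq_iff_eq_univ, Fintype.card_fin]
    exact le_antisymm ((Finset.card_le_univ S).trans_eq (Fintype.card_fin n)) hS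
  rw [this, uninformedFrac_univ]
  simp [shortfall, damp]

end RumorProcess.IsRun

/-! ### The spreading time as a count of incomplete rounds -/

section SpreadTime

variable {n : ℕ} {Ω : Type*} {X : ℕ → Ω → Finset (Fin n)} {m t : ℕ} {ω : Ω}

theorem spreadTime_le (h : m ≤ (X t ω).card) : spreadTime X m ω ≤ t :=
  iInf₂_le t h

theorem exists_of_spreadTime_lt (h : spreadTime X m ω < (t + 1 : ℕ)) :
    ∃ i ≤ t, m ≤ (X i ω).card := by
  by_contra! H
  refine h.not_ge (le_iInf₂ fun i hi => ?_)
  have : t < i := not_le.1 fun hit => (H i hit).not_ge hi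
  exact_mod_cast this

/-- After time `t` every round before the first hit contributes 1. If there is no hit, the sum is
infinite. -/
theorem spreadTime_le_add_tsum (t : ℕ) :
    spreadTime X m ω ≤ t + ∑' k : ℕ, {ω | (X (t + k) ω).card < m}.indicator 1 ω := by
  classical
  by_cases h : ∃ k, m ≤ (X (t + k) ω).card
  · refine (spreadTime_le (Nat.find_spec h)).trans ?_
    rw [Nat.cast_add]
    gcongr
    refine le_trans (le_of_eq ?_) (ENNReal.sum_le_tsum (Finset.range (Nat.find h)))
    rw [Finset.sum_congr rfl (g := fun _ => (1 : ℝ≥0∞))]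
    · simp
    · intro k hk
      have := not_le.1 (Nat.find_min h (Finset.mem_range.1 hk))
      simp [this]
  · push Not at h
    simp [h]

theorem sum_indicator_le_spreadTime (hmono : Monotone fun t => X t ω) (t : ℕ) :
    ∑ k ∈ Finset.range t, {ω | (X k ω).card < m}.indicator (1 : Ω → ℝ≥0∞) ω
      ≤ spreadTime X m ω := by
  refine le_iInf₂ fun i hi => ?_
  calc _ ≤ ∑ k ∈ Finset.range t, if k < i then (1 : ℝ≥0∞) else 0 := by
        refine Finset.sum_le_sum fun k _ => ?_
        by_cases hk : k < i
        · simp only [hk, if_true]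
          exact Set.indicator_le_self' (by simp) _
        · have := hi.trans (Finset.card_le_card (hmono (not_lt.1 hk)))
          simp [hk, this]
    _ ≤ i := by
        rw [Finset.sum_boole]
        have : ((Finset.range t).filter (· < i)).card ≤ i := by
          refine (Finset.card_le_card fun k hk => ?_).trans_eq (Finset.card_range i)
          exact Finset.mem_range.2 (Finset.mem_filter.1 hk).2
        exact_mod_cast this

end SpreadTime

namespace RumorProcess.IsRun

variable {n : ℕ} {Q : RumorProcess n} {Ω : Type*} [MeasurableSpace Ω] {P : Measure Ω}
  {X : ℕ → Ω → Finset (Fin n)}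

theorem lintegral_spreadTime_le [IsProbabilityMeasure P] (hX : Q.IsRun P X) (t : ℕ) {A r : ℝ}
    (hA : 0 ≤ A) (hr : 0 ≤ r) (hr1 : r < 1)
    (h : ∀ k, P.real {ω | (X (t + k) ω).card < n} ≤ A * r ^ k) :
    ∫⁻ ω, spreadTime X n ω ∂P ≤ ENNReal.ofReal (t + A * (1 - r)⁻¹) := by
  calc _ ≤ ∫⁻ ω, t + ∑' k : ℕ, {ω | (X (t + k) ω).card < n}.indicator 1 ω ∂P :=
        lintegral_mono fun ω => spreadTime_le_add_tsum t
    _ = t + ∑' k, P {ω | (X (t + k) ω).card < n} := by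
        rw [lintegral_add_left measurable_const, lintegral_tsum]
        · simp [hX.measurableSet_comp _ fun S => S.card < n]
        · intro k
          exact (measurable_const.indicator
            (hX.measurableSet_comp (t + k) fun S => S.card < n)).aemeasurable
    _ ≤ t + ∑' k, ENNReal.ofReal (A * r ^ k) := by
        gcongr with k
        rw [← ofReal_measureReal]
        exact ENNReal.ofReal_le_ofReal (h k)
    _ = ENNReal.ofReal (t + A * (1 - r)⁻¹) := by
        rw [← ENNReal.ofReal_tsum_of_nonneg (fun k => by positivity)
          ((summable_geometric_of_lt_one hr hr1).mul_left A), tsum_mul_left,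
          tsum_geometric_of_lt_one hr hr1, ENNReal.ofReal_add (by positivity)
            (mul_nonneg hA (inv_nonneg.2 (by linarith))), ENNReal.ofReal_natCast]

theorem le_lintegral_spreadTime [IsProbabilityMeasure P] (hX : Q.IsRun P X) (t : ℕ) {A r : ℝ}
    (hA : 0 ≤ A) (hr : 0 ≤ r) (hr1 : r < 1)
    (h : ∀ k < t, P.real {ω | n ≤ (X k ω).card} ≤ A * r ^ (t - k)) :
    ENNReal.ofReal (t - A * (1 - r)⁻¹) ≤ ∫⁻ ω, spreadTime X n ω ∂P := by
  calc _ ≤ ENNReal.ofReal (∑ k ∈ Finset.range t, P.real {ω | (X k ω).card < n}) := by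
        refine ENNReal.ofReal_le_ofReal ?_
        have h1 : ∀ k ∈ Finset.range t,
            1 - A * r ^ (t - 1 - k) ≤ P.real {ω | (X k ω).card < n} := by
          intro k hk
          have hk := Finset.mem_range.1 hk
          have e : {ω | (X k ω).card < n} = {ω | n ≤ (X k ω).card}ᶜ := by
            ext ω
            simp
          rw [e, probReal_compl_eq_one_sub (hX.measurableSet_comp k fun S => n ≤ S.card)]
          -- Weakening the exponent by one makes the sum the reflection of a geometric sum that
          -- starts at `r ^ 0`.
          have h2 : r ^ (t - k) ≤ r ^ (t - 1 - k) :=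
            pow_le_pow_of_le_one hr hr1.le (by omega)
          have := h k hk
          have := mul_le_mul_of_nonneg_left h2 hA
          linarith
        refine le_trans ?_ (Finset.sum_le_sum h1)
        rw [Finset.sum_sub_distrib, ← Finset.mul_sum, Finset.sum_range_reflect (fun j => r ^ j) t]
        have := (summable_geometric_of_lt_one hr hr1).sum_le_tsum (Finset.range t)
          fun k _ => by positivity
        rw [tsum_geometric_of_lt_one hr hr1] at this
        have := mul_le_mul_of_nonneg_left this hA
        simp
        linarith
    _ = ∑ k ∈ Finset.range t, P {ω | (X k ω).card < n} := by
        rw [ENNReal.ofReal_sum_of_nonneg fun _ _ => measureReal_nonneg]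
        simp
    _ = ∫⁻ ω, ∑ k ∈ Finset.range t, {ω | (X k ω).card < n}.indicator 1 ω ∂P := by
        rw [lintegral_finsetSum _ fun k _ => measurable_one.indicator
          (hX.measurableSet_comp k fun S => S.card < n)]
        refine Finset.sum_congr rfl fun k _ => ?_
        rw [← lintegral_indicator_one (hX.measurableSet_comp k fun S => S.card < n)]
    _ ≤ _ := by
        refine lintegral_mono_ae ?_
        filter_upwards [hX.ae_monotone] with ω hω
        exact sum_indicator_le_spreadTime hω t

end RumorProcess.IsRun

/-! ### Tails around `ln n / ρ` and the theorem -/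

theorem Real.exp_neg_two_mul_le_one_sub {x : ℝ} (h0 : 0 ≤ x) (h1 : x ≤ 1 / 2) :
    Real.exp (-(2 * x)) ≤ 1 - x := by
  rw [Real.exp_neg]
  refine inv_le_of_inv_le₀ (by linarith) ?_
  refine le_trans ?_ (Real.add_one_le_exp (2 * x))
  rw [inv_le_iff_one_le_mul₀ (by linarith)]
  nlinarith

theorem eventually_div_natCast_le (C : ℝ) {ε : ℝ} (hε : 0 < ε) :
    ∀ᶠ n : ℕ in atTop, C / n ≤ ε :=
  (tendsto_const_div_atTop_nhds_zero_nat C).eventually_le_const hε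

theorem EReal.coe_ennreal_natCast_eq (k : ℕ) : ((k : ℝ≥0∞) : EReal) = ((k : ℝ) : EReal) := by
  rw [← ENNReal.ofReal_natCast, EReal.coe_ennreal_ofReal, max_eq_left (Nat.cast_nonneg k)]

theorem one_div_mul_log_nonneg {n : ℕ} {ρ : ℝ} (hρ : 0 < ρ) : 0 ≤ 1 / ρ * Real.log n :=
  mul_nonneg (by positivity) (Real.log_natCast_nonneg n)

theorem one_div_mul_log_le {n : ℕ} {ρ ρ₀ : ℝ} (h0 : 0 < ρ₀) (hρ : ρ₀ ≤ ρ) :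
    1 / ρ * Real.log n ≤ n / ρ₀ := by
  have h1 : Real.log n ≤ n := Real.log_le_self (Nat.cast_nonneg n)
  have h2 := Real.log_natCast_nonneg n
  have h3 : 0 < ρ := h0.trans_le hρ
  calc _ ≤ 1 / ρ₀ * (n : ℝ) := by gcongr
    _ = _ := by ring

/-- With `L = ln n / ρ`, the factor `n` cancels `e^{-ρ L}`, and `(1 + C/n)^L ≤ e^{C/ρ₀}`. Once `C/n
≤ ρ₀/2`, each further round gains at least `e^{-ρ₀/2}`. -/
theorem UpperExpShrinking.exists_tail {Q : ∀ n, RumorProcess n} {ρ : ℕ → ℝ} {g a c : ℝ}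
    (h : UpperExpShrinking Q ρ g a c) :
    ∃ A β : ℝ, 0 < A ∧ 0 < β ∧ (∀ n, 0 < ρ n) ∧ ∀ᶠ n : ℕ in atTop,
      ∀ (Ω : Type*) [MeasurableSpace Ω] (P : Measure Ω) [IsProbabilityMeasure P]
        (X : ℕ → Ω → Finset (Fin n)), (Q n).IsRun P X →
        (∀ᵐ ω ∂P, (X 0 ω).card = n - ⌊g * n⌋₊) → ∀ k : ℕ,
        P.real {ω | (X (⌈1 / ρ n * Real.log n⌉₊ + k) ω).card < n} ≤ A * Real.exp (-β) ^ k := by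
  obtain ⟨ρ₀, ρ₁, hρ₀, hρ⟩ := h.rho_bdd
  obtain ⟨q, hq1, hq⟩ := h.shrink
  have ha := h.a_nonneg
  have hc := h.c_nonneg
  have hg := h.g_pos
  have hq1' : 0 < 1 - q := by linarith
  obtain ⟨K, hKdef⟩ : ∃ K, K = a * Real.exp ρ₁ / (1 - q) := ⟨_, rfl⟩
  have hK : 0 ≤ K := by rw [hKdef]; positivity
  have hKq : a * Real.exp ρ₁ ≤ K * (1 - q) := by rw [hKdef, div_mul_cancel₀ _ hq1'.ne']
  obtain ⟨C, hC⟩ : ∃ C, C = (K + (1 + Real.exp K) * K ^ 2) * (1 + c) * Real.exp ρ₁ := ⟨_, rfl⟩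
  have hC0 : 0 ≤ C := by rw [hC]; positivity
  refine ⟨Real.exp (K + C / ρ₀), ρ₀ / 2, Real.exp_pos _, by positivity,
    fun n => hρ₀.trans_le (hρ n).1, ?_⟩
  filter_upwards [h.stay_le, h.cov_le, hq, eventually_div_natCast_le C (half_pos hρ₀),
    eventually_gt_atTop 0] with n hstay hcov hqn hCn hn Ω _ P _ X hX h0 k
  have hn' : (0 : ℝ) < n := by exact_mod_cast hn
  obtain ⟨hρn, hρn'⟩ := hρ n
  have hρpos := hρ₀.trans_le hρn
  have hfl : (⌊g * n⌋₊ : ℝ) ≤ g * n := Nat.floor_le (by positivity)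
  have hfln : ⌊g * n⌋₊ ≤ n := by
    have : g * n ≤ 1 * n := by have := h.g_lt_one; gcongr
    exact_mod_cast hfl.trans (this.trans_eq (one_mul _))
  have key := hX.measureReal_card_lt_le (hX.ae_card_compl_le hfl hfln h0) hK
    (l := Real.exp (-ρ n) * (1 + C / n)) (by positivity)
    (by
      rw [hC]
      exact (Q n).upper_step h.g_lt_one ha hc hK hKq hρn' hstay hcov hqn)
    (⌈1 / ρ n * Real.log n⌉₊ + k)
  refine key.trans ?_
  obtain ⟨L, hL⟩ : ∃ L, L = 1 / ρ n * Real.log n := ⟨_, rfl⟩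
  have hLn : L / n ≤ 1 / ρ₀ := by
    rw [div_le_iff₀ hn', hL]
    exact (one_div_mul_log_le hρ₀ hρn).trans_eq (by ring)
  have hLρ : ρ n * L = Real.log n := by rw [hL]; field_simp
  rw [← hL]
  have hceil : L + k ≤ ((⌈L⌉₊ + k : ℕ) : ℝ) := by
    push_cast
    gcongr
    exact Nat.le_ceil L
  have hl : Real.exp (-ρ n) * (1 + C / n) ≤ Real.exp (-ρ n + C / n) := by
    rw [Real.exp_add]
    gcongr
    linarith [Real.add_one_le_exp (C / n)]
  calc _ ≤ n * Real.exp K * Real.exp (-ρ n + C / n) ^ (⌈L⌉₊ + k) := by gcongr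
    _ = Real.exp (Real.log n + K + ((⌈L⌉₊ + k : ℕ) : ℝ) * (-ρ n + C / n)) := by
        rw [← Real.exp_nat_mul, Real.exp_add, Real.exp_add, Real.exp_log hn']
    _ ≤ Real.exp (K + C / ρ₀ + k * (-(ρ₀ / 2))) := by
        refine Real.exp_le_exp.2 ?_
        -- Rounding up only helps, since `-ρ n + C / n` is negative.
        have h1 : ((⌈L⌉₊ + k : ℕ) : ℝ) * (-ρ n + C / n) ≤ (L + k) * (-ρ n + C / n) :=
          mul_le_mul_of_nonpos_right hceil (by linarith)
        have h2 : (k : ℝ) * (-ρ n + C / n) ≤ k * (-(ρ₀ / 2)) := by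
          gcongr
          linarith
        have h3 : L * (C / n) ≤ C / ρ₀ := by
          calc L * (C / n) = C * (L / n) := by ring
            _ ≤ C * (1 / ρ₀) := by gcongr
            _ = _ := by ring
        linarith
    _ = _ := by rw [Real.exp_add, Real.exp_nat_mul]

theorem LowerExpShrinking.exists_tail {Q : ∀ n, RumorProcess n} {ρ : ℕ → ℝ} {g a c : ℝ}
    (h : LowerExpShrinking Q ρ g a c) :
    ∃ A β : ℝ, 0 < A ∧ 0 < β ∧ (∀ n, 0 < ρ n) ∧ ∀ᶠ n : ℕ in atTop,
      ∀ (Ω : Type*) [MeasurableSpace Ω] (P : Measure Ω) [IsProbabilityMeasure P]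
        (X : ℕ → Ω → Finset (Fin n)), (Q n).IsRun P X →
        (∀ᵐ ω ∂P, (X 0 ω).card = n - ⌊g * n⌋₊) → ∀ t : ℕ, (t : ℝ) ≤ 1 / ρ n * Real.log n →
        P.real {ω | n ≤ (X t ω).card} ≤ A * Real.exp (-β * (1 / ρ n * Real.log n - t)) := by
  obtain ⟨ρ₀, ρ₁, hρ₀, hρ⟩ := h.rho_bdd
  obtain ⟨q, hq1, hq⟩ := h.success_le
  have ha := h.a_nonneg
  have hc := h.c_nonneg
  have hg := h.g_pos
  have hq1' : 0 < 1 - q := by linarith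
  have he : 0 < 1 - Real.exp (-ρ₀) := by
    have : Real.exp (-ρ₀) < 1 := by simpa using hρ₀
    linarith
  obtain ⟨K, hKdef⟩ : ∃ K, K = a / ((1 - q) * (1 - Real.exp (-ρ₀))) := ⟨_, rfl⟩
  have hK : 0 ≤ K := by rw [hKdef]; positivity
  have hKq : a ≤ K * (1 - q) * (1 - Real.exp (-ρ₀)) := by
    rw [mul_assoc, hKdef, div_mul_cancel₀ _ (by positivity)]
  obtain ⟨C, hC⟩ : ∃ C, C = K * ((1 + c) * (1 + K)) * Real.exp ρ₁ := ⟨_, rfl⟩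
  have hC0 : 0 ≤ C := by rw [hC]; positivity
  -- `d` is a lower bound, uniform in `n`, for `(1 - l) l m`: its factors bound `1 - l`, `l` and the
  -- initial damped fraction `m`.
  obtain ⟨d, hd⟩ : ∃ d, d = (1 - Real.exp (-ρ₀)) * (Real.exp (-ρ₁) / 2) * (g / 2 / (1 + K)) :=
    ⟨_, rfl⟩
  have hd0 : 0 < d := by rw [hd]; positivity
  obtain ⟨B, hBdef⟩ : ∃ B, B = (1 + c) * (1 + K) / d := ⟨_, rfl⟩
  have hB0 : 0 < B := by rw [hBdef]; positivity
  refine ⟨B * Real.exp (2 * C / ρ₀), ρ₀, by positivity, hρ₀, fun n => hρ₀.trans_le (hρ n).1, ?_⟩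
  filter_upwards [h.le_stay, h.cov_le, hq, eventually_div_natCast_le C one_half_pos,
    -- This gives `g n ≥ 2`, so the floor of `g n` is at least `g n / 2`.
    eventually_div_natCast_le (2 / g) one_pos,
    eventually_gt_atTop 0] with n hstay hcov hqn hCn hgn hn Ω _ P _ X hX h0 t ht
  have hn' : (0 : ℝ) < n := by exact_mod_cast hn
  obtain ⟨hρn, hρn'⟩ := hρ n
  have hρpos := hρ₀.trans_le hρn
  have hfl : (⌊g * n⌋₊ : ℝ) ≤ g * n := Nat.floor_le (by positivity)
  have hfln : ⌊g * n⌋₊ ≤ n := by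
    have : g * n ≤ 1 * n := by have := h.g_lt_one; gcongr
    exact_mod_cast hfl.trans (this.trans_eq (one_mul _))
  obtain ⟨l, hl⟩ : ∃ l, l = Real.exp (-ρ n) * (1 - C / n) := ⟨_, rfl⟩
  have hCn0 : 0 ≤ C / n := by positivity
  have hl0 : 0 < l := by
    rw [hl]
    exact mul_pos (Real.exp_pos _) (by linarith)
  have hl_lower : Real.exp (-ρ₁) / 2 ≤ l := by
    rw [hl, div_eq_mul_one_div]
    gcongr
    linarith
  have hl_upper : l ≤ Real.exp (-ρ₀) := by
    rw [hl]
    calc _ ≤ Real.exp (-ρ₀) * 1 :=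
          mul_le_mul (Real.exp_le_exp.2 (by linarith)) (by linarith) (by linarith) (Real.exp_pos _).le
      _ = _ := mul_one _
  have hl1 : 0 ≤ 1 - l := by linarith
  have hfrac : g / 2 ≤ (⌊g * n⌋₊ : ℝ) / n := by
    rw [le_div_iff₀ hn']
    have h1 := Nat.lt_floor_add_one (g * n)
    have h2 : 2 ≤ g * n := by
      rw [div_div, div_le_one (by positivity)] at hgn
      exact hgn
    linarith
  have hfrac1 : (⌊g * n⌋₊ : ℝ) / n ≤ 1 := by
    rw [div_le_one hn']
    exact_mod_cast hfln
  have hm : g / 2 / (1 + K) ≤ damp K ((⌊g * n⌋₊ : ℝ) / n) := by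
    rw [div_le_iff₀' (by positivity)]
    exact hfrac.trans (le_mul_damp hK (by positivity) hfrac1)
  have hm0 : 0 < damp K ((⌊g * n⌋₊ : ℝ) / n) := lt_of_lt_of_le (by positivity) hm
  have hinit : ∀ᵐ ω ∂P, RumorProcess.uninformedFrac (X 0 ω) = (⌊g * n⌋₊ : ℝ) / n := by
    filter_upwards [h0] with ω hω
    rw [RumorProcess.uninformedFrac, Finset.card_compl, Fintype.card_fin, hω, Nat.sub_sub_self hfln]
  have key := hX.measureReal_le_card_le (hX.ae_card_compl_le hfl hfln h0) (K := K)
    (σ := (1 + c) * (1 + K)) hl0 hm0 rfl hinit hB0.le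
    (by
      calc (1 + c) * (1 + K) = B * d := by rw [hBdef, div_mul_cancel₀ _ hd0.ne']
        _ ≤ _ := by
          rw [hd]
          gcongr)
    (fun m hm S hS => (Q n).lower_step h.g_lt_one hc hK hKq hρ₀ hρn hρn' hstay hcov hqn hm hl0
      (by rw [hl, hC]) S hS) t
  refine key.trans ?_
  obtain ⟨L, hL⟩ : ∃ L, L = 1 / ρ n * Real.log n := ⟨_, rfl⟩
  rw [← hL] at ht ⊢
  have hLn : L / n ≤ 1 / ρ₀ := by
    rw [div_le_iff₀ hn', hL]
    exact (one_div_mul_log_le hρ₀ hρn).trans_eq (by ring)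
  have hLρ : ρ n * L = Real.log n := by rw [hL]; field_simp
  have hle : Real.exp (-ρ n - 2 * (C / n)) ≤ l := by
    rw [hl, sub_eq_add_neg, Real.exp_add]
    gcongr
    exact Real.exp_neg_two_mul_le_one_sub hCn0 hCn
  calc _ ≤ B / n / Real.exp (-ρ n - 2 * (C / n)) ^ t := by gcongr
    _ = B * Real.exp (t * (ρ n + 2 * (C / n)) - Real.log n) := by
        rw [← Real.exp_nat_mul, Real.exp_sub, Real.exp_log hn', div_div, mul_comm (n : ℝ),
          ← div_div, div_eq_mul_inv B, ← Real.exp_neg, ← mul_div_assoc]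
        ring_nf
    _ ≤ B * Real.exp (2 * C / ρ₀ + -ρ₀ * (L - t)) := by
        gcongr
        have h1 : t * (C / n) ≤ C / ρ₀ := by
          calc t * (C / n) ≤ L * (C / n) := by gcongr
            _ = C * (L / n) := by ring
            _ ≤ C * (1 / ρ₀) := by gcongr
            _ = _ := by ring
        have h2 : ρ₀ * (L - t) ≤ ρ n * (L - t) := by
          have : 0 ≤ L - t := by linarith
          gcongr
        have h3 : 2 * C / ρ₀ = 2 * (C / ρ₀) := by ring
        linarith
    _ = _ := by rw [Real.exp_add, mul_assoc]

theorem mainTheorem2 (Q : ∀ n, RumorProcess n) (ρ : ℕ → ℝ) (g a c : ℝ) :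
    (UpperExpShrinking Q ρ g a c →
      ∃ C A α : ℝ, 0 < A ∧ 0 < α ∧ ∀ᶠ n : ℕ in atTop,
        ∀ (Ω : Type*) [MeasurableSpace Ω] (P : Measure Ω) [IsProbabilityMeasure P]
          (X : ℕ → Ω → Finset (Fin n)), (Q n).IsRun P X →
          (∀ᵐ ω ∂P, (X 0 ω).card = n - ⌊g * n⌋₊) →
          ((∫⁻ ω, spreadTime X n ω ∂P : ℝ≥0∞) : EReal)
              ≤ ((1 / ρ n * Real.log n + C : ℝ) : EReal) ∧
          ∀ r : ℕ,
            P.real {ω | ((1 / ρ n * Real.log n + r : ℝ) : EReal) ≤ (spreadTime X n ω : EReal)}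
              ≤ A * Real.exp (-α * r)) ∧
    (LowerExpShrinking Q ρ g a c →
      ∃ C A α : ℝ, 0 < A ∧ 0 < α ∧ ∀ᶠ n : ℕ in atTop,
        ∀ (Ω : Type*) [MeasurableSpace Ω] (P : Measure Ω) [IsProbabilityMeasure P]
          (X : ℕ → Ω → Finset (Fin n)), (Q n).IsRun P X →
          (∀ᵐ ω ∂P, (X 0 ω).card = n - ⌊g * n⌋₊) →
          ((1 / ρ n * Real.log n - C : ℝ) : EReal)
              ≤ ((∫⁻ ω, spreadTime X n ω ∂P : ℝ≥0∞) : EReal) ∧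
          ∀ r : ℕ,
            P.real {ω | (spreadTime X n ω : EReal) ≤ ((1 / ρ n * Real.log n - r : ℝ) : EReal)}
              ≤ A * Real.exp (-α * r)) := by
  constructor
  · intro h
    obtain ⟨A, β, hA, hβ, hρ, htail⟩ := h.exists_tail
    have hβ1 : Real.exp (-β) < 1 := by simpa using hβ
    have hβ0 := Real.exp_pos (-β)
    -- The summand 1 pays for the ceiling. The factor `e^{2β}` and `A + 1 ≥ 1` make the tail bound
    -- trivial for `r < 2`; otherwise `k = r - 2` rounds after the ceiling still end before `L + r`.
    refine ⟨1 + A * (1 - Real.exp (-β))⁻¹, (A + 1) * Real.exp (2 * β), β, by positivity, hβ, ?_⟩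
    filter_upwards [htail] with n htail Ω _ P _ X hX h0
    have hL0 : 0 ≤ 1 / ρ n * Real.log n := one_div_mul_log_nonneg (hρ n)
    have htail := htail Ω P X hX h0
    generalize 1 / ρ n * Real.log n = L at hL0 htail
    have hceil := Nat.ceil_lt_add_one hL0
    have hinv : 0 ≤ (1 - Real.exp (-β))⁻¹ := inv_nonneg.2 (by linarith)
    refine ⟨?_, fun r => ?_⟩
    · have h1 := hX.lintegral_spreadTime_le _ hA.le hβ0.le hβ1 htail
      have h2 : ∫⁻ ω, spreadTime X n ω ∂P
          ≤ ENNReal.ofReal (L + (1 + A * (1 - Real.exp (-β))⁻¹)) :=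
        h1.trans (ENNReal.ofReal_le_ofReal (by linarith))
      refine (EReal.coe_ennreal_le_coe_ennreal_iff.2 h2).trans_eq ?_
      rw [EReal.coe_ennreal_ofReal, max_eq_left (by positivity)]
    · rcases lt_or_ge r 2 with hr | hr
      · refine measureReal_le_one.trans ?_
        have h1 : (1 : ℝ) ≤ Real.exp (2 * β) * Real.exp (-β * r) := by
          rw [← Real.exp_add]
          refine Real.one_le_exp ?_
          have : (r : ℝ) ≤ 2 := by exact_mod_cast hr.le
          nlinarith
        rw [mul_assoc]
        exact one_le_mul_of_one_le_of_one_le (by linarith) h1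
      · obtain ⟨k, rfl⟩ := Nat.exists_eq_add_of_le' hr
        calc _ ≤ P.real {ω | (X (⌈L⌉₊ + k) ω).card < n} := by
              refine measureReal_mono fun ω hω => ?_
              by_contra hcard
              have h1 : spreadTime X n ω ≤ ((⌈L⌉₊ + k : ℕ) : ℝ≥0∞) := spreadTime_le (not_lt.1 hcard)
              have h2 := hω.trans (EReal.coe_ennreal_le_coe_ennreal_iff.2 h1)
              rw [EReal.coe_ennreal_natCast_eq, EReal.coe_le_coe_iff] at h2
              push_cast at h2
              linarith
          _ ≤ A * Real.exp (-β) ^ k := htail k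
          _ ≤ (A + 1) * Real.exp (-β) ^ k := by gcongr; linarith
          _ = _ := by
              rw [mul_assoc, ← Real.exp_add, ← Real.exp_nat_mul]
              push_cast
              ring_nf
  · intro h
    obtain ⟨A, β, hA, hβ, hρ, htail⟩ := h.exists_tail
    have hβ1 : Real.exp (-β) < 1 := by simpa using hβ
    have hβ0 := Real.exp_pos (-β)
    refine ⟨1 + A * (1 - Real.exp (-β))⁻¹, A, β, hA, hβ, ?_⟩
    filter_upwards [htail] with n htail Ω _ P _ X hX h0
    have hL0 : 0 ≤ 1 / ρ n * Real.log n := one_div_mul_log_nonneg (hρ n)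
    have htail := htail Ω P X hX h0
    generalize 1 / ρ n * Real.log n = L at hL0 htail
    refine ⟨?_, fun r => ?_⟩
    · have hfloor := Nat.floor_le hL0
      have hfloor' := Nat.lt_floor_add_one L
      have h1 := hX.le_lintegral_spreadTime ⌊L⌋₊ hA.le hβ0.le hβ1 fun k hk => by
        have hk' : (k : ℝ) ≤ ⌊L⌋₊ := by exact_mod_cast hk.le
        refine (htail k (hk'.trans hfloor)).trans ?_
        rw [← Real.exp_nat_mul, Nat.cast_sub hk.le]
        exact mul_le_mul_of_nonneg_left (Real.exp_le_exp.2 (by nlinarith)) hA.le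
      refine le_trans ?_ (EReal.coe_ennreal_le_coe_ennreal_iff.2 h1)
      rw [EReal.coe_ennreal_ofReal, EReal.coe_le_coe_iff]
      exact le_max_of_le_left (by linarith)
    · rcases lt_or_ge (L - r) 0 with hr | hr
      -- The comparison in `EReal` does not truncate the negative number `L - r`, so no spreading
      -- time lies below it.
      · have : {ω | (spreadTime X n ω : EReal) ≤ ((L - r : ℝ) : EReal)} = ∅ := by
          ext ω
          simp only [Set.mem_ofPred_eq, Set.mem_empty_iff_false, iff_false, not_le]
          exact lt_of_lt_of_le (by exact_mod_cast hr) (EReal.coe_ennreal_nonneg _)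
        rw [this, measureReal_empty]
        positivity
      · have hfloor := Nat.floor_le hr
        have hr0 : (0 : ℝ) ≤ r := Nat.cast_nonneg r
        calc _ ≤ P.real {ω | n ≤ (X ⌊L - r⌋₊ ω).card} := by
              refine ENNReal.toReal_mono (measure_ne_top _ _) (measure_mono_ae ?_)
              filter_upwards [hX.ae_monotone] with ω hmono hω
              have h1 : spreadTime X n ω < (⌊L - r⌋₊ + 1 : ℕ) := by
                rw [← EReal.coe_ennreal_lt_coe_ennreal_iff, EReal.coe_ennreal_natCast_eq]
                refine lt_of_le_of_lt hω (EReal.coe_lt_coe_iff.2 ?_)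
                push_cast
                exact Nat.lt_floor_add_one (L - r)
              obtain ⟨i, hi, hcard⟩ := exists_of_spreadTime_lt h1
              exact hcard.trans (Finset.card_le_card (hmono hi))
          _ ≤ A * Real.exp (-β * (L - ⌊L - r⌋₊)) := htail _ (by linarith)
          _ ≤ _ := mul_le_mul_of_nonneg_left (Real.exp_le_exp.2 (by nlinarith)) hA.le
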